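/- For a finite Markov chain with a unique stationary distribution $\pi$, let $m_{ij}$ be the expected value of the hitting time $\min\{n\ge 0 : X_n=j\}$ of the state $j$ for the chain started at $X_0=i$ (so $m_{jj}=0$). If $\sum_j \pi_j m_{ij}$ is finite and independent of $i$, its common value is called Kemeny's constant of the chain. Kemeny's constant $\mathscr{K}(G)$ of a finite simple connected graph $G$ is that of the simple random walk on $G$, which moves at each step to a uniformly random neighbour of the current vertex. Let $a\ge 1$ and $b,c\ge 0$ be integers with $a+b+c\ge 2$. The barbell graph $B(1,a,b,c)$ is the simple graph on $a+b+c$ vertices consisting of a path $P_a$ on $a$ vertices, a complete graph $K_b$ all of whose vertices are joined to the first vertex of the path, and a complete graph $K_c$ all of whose vertices are joined to the last vertex of the path. (Thus it is $K_{b+1}$ and $K_{c+1}$ joined by the path $P_a$, whose end vertices belong to the two complete graphs; if $a=1$, the two complete graphs share a vertex.) **Theorem.** The simple random walk on $G=B(1,a,b,c)$ has a unique stationary distribution, the sum $\sum_j \pi_j m_{ij}$ is finite and does not depend on the vertex $i$, and Kemeny's constant of $G$ is $$\mathscr{K}(G) = \frac{1}{m}\left[\binom{b+1}{2}\left(\frac{b^2}{b+1}+(a-1)^2+\frac{2c^2}{c+1}\right)+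 (a-1)\left(\frac{2a^2-4a+3}{6}+\frac{2b^2}{b+1}+\frac{2c^2}{c+1}\right)+\binom{c+1}{2}\left(\frac{c^2}{c+1}+(a-1)^2+\frac{2b^2}{b+1}\right)+2\binom{b+1}{2}\binom{c+1}{2}(a-1)\right],$$ where $m=\binom{b+1}{2}+\binom{c+1}{2}+a-1$. -/

import Mathlib

open MeasureTheory ProbabilityTheory
open scoped ENNReal

/-- The σ-algebra on a disjoint union of two discrete measurable spaces is discrete. -/
instance sumDiscreteMeasurableSpace {α β : Type*} [MeasurableSpace α] [MeasurableSpace β]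
    [DiscreteMeasurableSpace α] [DiscreteMeasurableSpace β] :
    DiscreteMeasurableSpace (α ⊕ β) where
  forall_measurableSet _ :=
    measurableSet_sum_iff.2 ⟨MeasurableSet.of_discrete, MeasurableSet.of_discrete⟩

namespace MarkovChain

/-! Time-homogeneous Markov chains on a countable state space `V`, given by their transition
probabilities `P : V → PMF V` (`P i j` is the probability of stepping from `i` to `j`). -/

section

variable {V : Type*} [Countable V] [MeasurableSpace V] [DiscreteMeasurableSpace V]

/-- The law of the next state, given the trajectory up to time `n`: it is `P` at the state
occupied at time `n`. -/
noncomputable def stepKernel (P : V → PMF V) (n : ℕ) :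
    Kernel (∀ _ : Finset.Iic n, V) V :=
  (Kernel.ofFunOfCountable fun v => (P v).toMeasure).comap
    (fun x => x ⟨n, Finset.mem_Iic.2 le_rfl⟩) (measurable_pi_apply _)

instance stepKernel.isMarkovKernel (P : V → PMF V) (n : ℕ) :
    IsMarkovKernel (stepKernel P n) where
  isProbabilityMeasure x := by
    change IsProbabilityMeasure (P (x ⟨n, Finset.mem_Iic.2 le_rfl⟩)).toMeasure
    infer_instance

/-- The law, on the space `ℕ → V` of trajectories, of the Markov chain with transition
probabilities `P` and initial state `i`. -/
noncomputable def pathMeasure (P : V → PMF V) (i : V) : Measure (ℕ → V) :=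
  Kernel.traj (X := fun _ => V) (stepKernel P) 0 (fun _ => i)

/-- The first time `n ≥ 0` at which the trajectory `ω` is at `j` (it is `∞` if there is none). -/
noncomputable def hittingTime (j : V) (ω : ℕ → V) : ℝ≥0∞ :=
  ⨅ (n : ℕ) (_ : ω n = j), (n : ℝ≥0∞)

/-- The expected hitting time `m_{ij}` of `j` for the chain started at `i`. -/
noncomputable def meanHittingTime (P : V → PMF V) (i j : V) : ℝ≥0∞ :=
  ∫⁻ ω, hittingTime j ω ∂(pathMeasure P i)

/-- The probability distribution `π` is stationary: `∑ i, π i * P i j = π j` for all `j`. -/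
def IsStationary (P : V → PMF V) (π : PMF V) : Prop :=
  π.bind P = π

/-- Kemeny's constant of the chain `P` is well defined and equal to the real number `K`: there is
exactly one stationary distribution `π`, and for every initial state `i` the sum
`∑ j, π j * m_{ij}` is finite and equal to `K`. -/
def HasKemenyConstant [Fintype V] (P : V → PMF V) (K : ℝ) : Prop :=
  (∃! π : PMF V, IsStationary P π) ∧
    ∀ π : PMF V, IsStationary P π → ∀ i : V,
      (∑ j, π j * meanHittingTime P i j) ≠ ∞ ∧
        (∑ j, π j * meanHittingTime P i j).toReal = K

end

end MarkovChain

open Classical in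
/-- The simple random walk on a finite graph: from `v`, step to a uniformly random neighbour of
`v` (a walk at an isolated vertex stays there). -/
noncomputable def SimpleGraph.randomWalk {V : Type*} [Fintype V] (G : SimpleGraph V) (v : V) :
    PMF V :=
  if h : (G.neighborFinset v).Nonempty then PMF.uniformOfFinset (G.neighborFinset v) h
  else PMF.pure v

/-- The vertices of the barbell: those of `K_b`, those of the path `P_a`, those of `K_c`. -/
abbrev BarbellVertex (a b c : ℕ) : Type := Fin b ⊕ Fin a ⊕ Fin c

/-- One orientation of each edge of the barbell (with loops, which are discarded below). -/
def barbellRel (a b c : ℕ) : BarbellVertex a b c → BarbellVertex a b c → Prop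
  | .inl _, .inl _ => True
  | .inl _, .inr (.inl s) => (s : ℕ) = 0
  | .inr (.inl s), .inr (.inl t) => (s : ℕ) + 1 = t
  | .inr (.inl s), .inr (.inr _) => (s : ℕ) + 1 = a
  | .inr (.inr _), .inr (.inr _) => True
  | _, _ => False

/-- The barbell graph `B(1, a, b, c)` on `a + b + c` vertices: a path `P_a`, a complete graph
`K_b` all of whose vertices are joined to the first vertex of the path, and a complete graph `K_c`
all of whose vertices are joined to the last vertex of the path. -/
def barbell (a b c : ℕ) : SimpleGraph (BarbellVertex a b c) :=
  SimpleGraph.fromRel (barbellRel a b c)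

/-! Hitting times of a random walk can be read off from effective resistances. Let `r` vanish on the
diagonal, satisfy the triangle inequality, and have a Laplacian in the first variable equal to `τ i
- 2 δ_ij`. Put `h i j = ½ ∑ l, d_l (r i j + r j l - r i l)` and `S = ∑ d_l`. The terms in `τ`
cancel, the Laplacian of `h (·, j)` is `d_i - S δ_ij`, and away from `j` this is the first-step
equation. On a finite state space a finite nonnegative solution of these equations is the mean
hitting time, and it also forces the stationary distribution. Averaging `h i j` over `j` with
weights `d_j / S` removes `i` and leaves `∑ d_j d_k r j k / (2 S)`
(`hasKemenyConstant_of_resistance`).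

The barbell is a chain of blocks, two complete graphs and the path edges between them. Resistance
adds along such a chain, is `2 / n` between distinct vertices of `K_n`, and is `1` across an edge.
This gives an explicit `r`. Its Laplacian is checked in `laplacian_resistance` and its
degree-weighted double sum is evaluated block by block in `sum_sum_resistance`. -/

namespace MarkovChain

/-! ### Hitting times as tail sums, and the Markov property. -/

section HittingTimes

variable {V : Type*}

/-- The trajectories that have not visited `j` up to time `n`. -/
def avoiding (j : V) (n : ℕ) : Set (ℕ → V) := {ω | ∀ k ≤ n, ω k ≠ j}

lemma mem_avoiding {j : V} {n : ℕ} {ω : ℕ → V} : ω ∈ avoiding j n ↔ ∀ k ≤ n, ω k ≠ j := by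
  simp [avoiding]

lemma mem_avoiding_succ {j : V} {n : ℕ} {ω : ℕ → V} :
    ω ∈ avoiding j (n + 1) ↔ ω ∈ avoiding j n ∧ ω (n + 1) ≠ j := by
  simp only [mem_avoiding, Nat.le_succ_iff]
  constructor
  · exact fun h => ⟨fun k hk => h k (Or.inl hk), h _ (Or.inr rfl)⟩
  · rintro ⟨h1, h2⟩ k (hk | rfl)
    exacts [h1 k hk, h2]

/-- A hitting time `T` is the number of `n` with `T > n`, also when `T = ∞`. -/
lemma hittingTime_eq_tsum (j : V) (ω : ℕ → V) :
    hittingTime j ω = ∑' n, (avoiding j n).indicator 1 ω := by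
  classical
  by_cases h : ∃ n, ω n = j
  · have hmem : ∀ n, ω ∈ avoiding j n ↔ n < Nat.find h := fun n =>
      mem_avoiding.trans (Nat.lt_find_iff h n).symm
    have h1 : hittingTime j ω = (Nat.find h : ℝ≥0∞) := by
      refine le_antisymm (iInf₂_le (Nat.find h) (Nat.find_spec h)) (le_iInf₂ fun n hn => ?_)
      exact_mod_cast Nat.find_min' h hn
    rw [h1, tsum_eq_sum (s := Finset.range (Nat.find h))]
    · rw [Finset.sum_congr rfl fun n hn => Set.indicator_of_mem
        ((hmem n).2 (Finset.mem_range.1 hn)) _]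
      simp
    · intro n hn
      exact Set.indicator_of_notMem (fun h' => hn (Finset.mem_range.2 ((hmem n).1 h'))) _
  · push Not at h
    have h1 : hittingTime j ω = ∞ := by simp [hittingTime, h]
    have h2 : ∀ n, (avoiding j n).indicator (1 : (ℕ → V) → ℝ≥0∞) ω = 1 :=
      fun n => Set.indicator_of_mem (mem_avoiding.2 fun k _ => h k) _
    rw [h1, tsum_congr h2, ENNReal.tsum_const_eq_top_of_ne_zero one_ne_zero]

variable [MeasurableSpace V] [DiscreteMeasurableSpace V]

lemma measurableSet_avoiding (j : V) (n : ℕ) : MeasurableSet (avoiding j n) := by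
  have : avoiding j n = ⋂ k ≤ n, (fun ω : ℕ → V => ω k) ⁻¹' {j}ᶜ := by
    ext ω; simp [avoiding]
  rw [this]
  exact MeasurableSet.biInter (Set.to_countable _) fun k _ =>
    measurable_pi_apply k MeasurableSet.of_discrete

variable [Countable V]

instance (P : V → PMF V) (i : V) : IsProbabilityMeasure (pathMeasure P i) := by
  unfold pathMeasure; infer_instance

lemma meanHittingTime_eq_tsum (P : V → PMF V) (i j : V) :
    meanHittingTime P i j = ∑' n, pathMeasure P i (avoiding j n) := by
  simp_rw [meanHittingTime, hittingTime_eq_tsum]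
  rw [lintegral_tsum fun n =>
    (measurable_one.indicator (measurableSet_avoiding j n)).aemeasurable]
  simp [measurableSet_avoiding]

lemma map_pathMeasure_zero (P : V → PMF V) (i : V) :
    (pathMeasure P i).map (fun ω => ω 0) = Measure.dirac i := by
  have h : (fun ω : ℕ → V => ω 0) =
      (fun x : (∀ _ : Finset.Iic 0, V) => x ⟨0, Finset.mem_Iic.2 le_rfl⟩) ∘
        Preorder.frestrictLe 0 := rfl
  rw [h, ← Measure.map_map (measurable_pi_apply _) (by fun_prop), pathMeasure,
    Kernel.traj_map_frestrictLe_apply, Kernel.partialTraj_self, Kernel.id_apply,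
    Measure.map_dirac' (measurable_pi_apply _)]

/-- The Markov property at time `n`. -/
lemma lintegral_pathMeasure_succ (P : V → PMF V) (i : V) (n : ℕ)
    (f : (∀ _ : Finset.Iic n, V) → ℝ≥0∞) (hf : Measurable f) (g : V → ℝ≥0∞) :
    ∫⁻ ω, f (Preorder.frestrictLe n ω) * g (ω (n + 1)) ∂pathMeasure P i =
      ∫⁻ ω, f (Preorder.frestrictLe n ω) * ∫⁻ k, g k ∂(P (ω n)).toMeasure ∂pathMeasure P i := by
  have hg : Measurable g := Measurable.of_discrete
  -- The joint law of the trajectory up to `n` and the next state is the law of the former composed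
  -- with the step kernel.
  have key := Kernel.partialTraj_compProd_eq_map_traj (X := fun _ => V) (κ := stepKernel P)
    (Nat.zero_le n) (x₀ := fun _ => i)
  have hF : Measurable fun p : (∀ _ : Finset.Iic n, V) × V => f p.1 * g p.2 := by fun_prop
  have h1 := lintegral_map (μ := pathMeasure P i) hF
    (g := fun ω => (Preorder.frestrictLe n ω, ω (n + 1))) (by fun_prop)
  rw [← h1]
  unfold pathMeasure
  rw [← key, Measure.lintegral_compProd hF, ← Kernel.traj_map_frestrictLe_apply,
    lintegral_map]
  · refine lintegral_congr fun ω => ?_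
    exact lintegral_const_mul (μ := (P (ω n)).toMeasure) (f (Preorder.frestrictLe n ω)) hg
  · exact hF.lintegral_kernel_prod_right'
  · fun_prop

end HittingTimes

/-! ### First-step equations and stationary distributions. -/

section FirstStep

variable {V : Type*} [Fintype V]

/-- The stationary mass of `j` is the reciprocal of its mean return time. -/
theorem IsStationary.apply_mul_eq_one {P : V → PMF V} {π : PMF V} (hπ : IsStationary P π) (j : V)
    (h : V → ℝ≥0∞) (hfin : ∀ i, h i ≠ ∞) (hj : h j = 0)
    (hstep : ∀ i ≠ j, h i = 1 + ∑ k, P i k * h k) : π j * (1 + ∑ k, P j k * h k) = 1 := by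
  classical
  have hbal : ∀ k, ∑ i, π i * P i k = π k := fun k => by
    conv_rhs => rw [← (hπ : π.bind P = π)]
    rw [PMF.bind_apply, tsum_fintype]
  have hsum : ∑ i, π i = 1 := (tsum_fintype _).symm.trans π.tsum_coe
  -- The `π`-average of `1 + P h` is evaluated twice: stationarity turns `πP` into `π`, and the
  -- first-step equations turn `1 + P h` into `h` except at `j`. The common term `∑ π h` is finite,
  -- so it cancels.
  have h1 : ∑ i, π i * (1 + ∑ k, P i k * h k) = 1 + ∑ i, π i * h i := by
    simp_rw [mul_add, mul_one, Finset.sum_add_distrib, hsum, Finset.mul_sum]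
    rw [Finset.sum_comm]
    simp_rw [← mul_assoc, ← Finset.sum_mul, hbal]
  have h2 : ∑ i, π i * (1 + ∑ k, P i k * h k) =
      π j * (1 + ∑ k, P j k * h k) + ∑ i, π i * h i := by
    rw [← Finset.add_sum_erase _ _ (Finset.mem_univ j),
      ← Finset.add_sum_erase (a := j) _ (fun i => π i * h i) (Finset.mem_univ j), hj, mul_zero,
      zero_add]
    congr 1
    exact Finset.sum_congr rfl fun i hi => by rw [hstep i (Finset.ne_of_mem_erase hi)]
  have hne : ∑ i, π i * h i ≠ ∞ :=
    ENNReal.sum_ne_top.2 fun i _ => ENNReal.mul_ne_top (π.apply_ne_top i) (hfin i)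
  exact (ENNReal.add_left_inj hne).1 (h2.symm.trans h1)

variable [MeasurableSpace V] [DiscreteMeasurableSpace V]

lemma lintegral_toMeasure (p : PMF V) (g : V → ℝ≥0∞) :
    ∫⁻ k, g k ∂p.toMeasure = ∑ k, p k * g k := by
  rw [lintegral_fintype]
  exact Finset.sum_congr rfl fun k _ => by
    rw [PMF.toMeasure_apply_singleton _ _ MeasurableSet.of_discrete, mul_comm]

/-- A finite solution of the first-step equations for the hitting time of `j` is the mean hitting
time. -/
theorem meanHittingTime_eq_of_firstStep (P : V → PMF V) (j : V) (h : V → ℝ≥0∞)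
    (hfin : ∀ i, h i ≠ ∞) (hj : h j = 0) (hstep : ∀ i ≠ j, h i = 1 + ∑ k, P i k * h k) (i : V) :
    meanHittingTime P i j = h i := by
  classical
  -- `E n` is the expected value of `h` at time `n` on the event that `j` has not yet been visited,
  -- the remainder after `n` terms of the tail sum.
  set E : ℕ → ℝ≥0∞ := fun n =>
    ∫⁻ ω, (avoiding j n).indicator (fun ω => h (ω n)) ω ∂pathMeasure P i with hE
  have hE0 : E 0 = h i := by
    have h1 : ∀ ω : ℕ → V, (avoiding j 0).indicator (fun ω => h (ω 0)) ω = h (ω 0) := by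
      intro ω
      by_cases hω : ω 0 = j
      · rw [Set.indicator_of_notMem (fun h' => mem_avoiding.1 h' 0 le_rfl hω), hω, hj]
      · refine Set.indicator_of_mem (mem_avoiding.2 fun k hk => ?_) _
        rwa [Nat.le_zero.1 hk]
    simp only [hE, h1]
    rw [← lintegral_map (f := h) (g := fun ω : ℕ → V => ω 0) Measurable.of_discrete
      (measurable_pi_apply 0), map_pathMeasure_zero,
      lintegral_dirac' _ Measurable.of_discrete]
  have hEsucc : ∀ n, E n = pathMeasure P i (avoiding j n) + E (n + 1) := by
    intro n
    set A : Set (∀ _ : Finset.Iic n, V) := {x | ∀ k, x k ≠ j} with hA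
    have hAm : MeasurableSet A := by
      have : A = ⋂ k, (fun x => x k) ⁻¹' {j}ᶜ := by ext x; simp [hA]
      rw [this]
      exact MeasurableSet.iInter fun k => measurable_pi_apply k MeasurableSet.of_discrete
    have hAmem : ∀ ω : ℕ → V, Preorder.frestrictLe n ω ∈ A ↔ ω ∈ avoiding j n := by
      intro ω
      constructor
      · exact fun h' => mem_avoiding.2 fun k hk => h' ⟨k, Finset.mem_Iic.2 hk⟩
      · exact fun h' k => mem_avoiding.1 h' k (Finset.mem_Iic.1 k.2)
    have hind : ∀ ω : ℕ → V, A.indicator (1 : (∀ _ : Finset.Iic n, V) → ℝ≥0∞)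
        (Preorder.frestrictLe n ω) =
        (avoiding j n).indicator 1 ω := by
      intro ω
      by_cases hω : ω ∈ avoiding j n
      · rw [Set.indicator_of_mem hω, Set.indicator_of_mem ((hAmem ω).2 hω)]; rfl
      · rw [Set.indicator_of_notMem hω, Set.indicator_of_notMem (mt (hAmem ω).1 hω)]
    have key := lintegral_pathMeasure_succ P i n (A.indicator 1) (measurable_one.indicator hAm) h
    simp only [hind, lintegral_toMeasure] at key
    -- Since `h j = 0`, avoiding `j` at time `n + 1` need not be required, so the event depends only
    -- on the past and the Markov property applies.
    have h1 : E (n + 1) =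
        ∫⁻ ω, (avoiding j n).indicator 1 ω * h (ω (n + 1)) ∂pathMeasure P i := by
      refine lintegral_congr fun ω => ?_
      by_cases hω : ω ∈ avoiding j n
      · by_cases hω' : ω (n + 1) = j
        · rw [Set.indicator_of_notMem (fun h' => (mem_avoiding_succ.1 h').2 hω'), hω', hj, mul_zero]
        · rw [Set.indicator_of_mem (mem_avoiding_succ.2 ⟨hω, hω'⟩), Set.indicator_of_mem hω]
          simp
      · rw [Set.indicator_of_notMem (fun h' => hω (mem_avoiding_succ.1 h').1),
          Set.indicator_of_notMem hω, zero_mul]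
    rw [h1, key, ← lintegral_indicator_one (measurableSet_avoiding j n), ← lintegral_add_left
      (measurable_one.indicator (measurableSet_avoiding j n))]
    refine lintegral_congr fun ω => ?_
    by_cases hω : ω ∈ avoiding j n
    · simp only [Set.indicator_of_mem hω, Pi.one_apply, one_mul]
      exact hstep _ (mem_avoiding.1 hω n le_rfl)
    · simp [Set.indicator_of_notMem hω]
  have hsum : ∀ N, ∑ n ∈ Finset.range N, pathMeasure P i (avoiding j n) + E N = h i := by
    intro N
    induction N with
    | zero => simpa using hE0
    | succ N ih => rw [Finset.sum_range_succ, add_assoc, ← hEsucc, ih]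
  have hle : ∑' n, pathMeasure P i (avoiding j n) ≤ h i :=
    ENNReal.tsum_le_of_sum_range_le fun N => (hsum N) ▸ le_self_add
  have hlim0 := ENNReal.tendsto_atTop_zero_of_tsum_ne_top (ne_top_of_le_ne_top (hfin i) hle)
  -- The remainder vanishes in the limit: `h` is bounded by `∑ k, h k`, and the avoidance
  -- probabilities tend to `0` because their series is at most `h i`.
  have hEle : ∀ N, E N ≤ (∑ k, h k) * pathMeasure P i (avoiding j N) := by
    intro N
    rw [← lintegral_indicator_const (measurableSet_avoiding j N)]
    refine lintegral_mono fun ω => Set.indicator_le_indicator ?_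
    exact Finset.single_le_sum (f := h) (fun _ _ => zero_le) (Finset.mem_univ _)
  have hElim : Filter.Tendsto E Filter.atTop (nhds 0) := by
    refine tendsto_of_tendsto_of_tendsto_of_le_of_le tendsto_const_nhds ?_
      (fun _ => zero_le) hEle
    have := ENNReal.Tendsto.const_mul hlim0
      (Or.inr (ENNReal.sum_ne_top.2 fun k _ => hfin k : ∑ k, h k ≠ ∞))
    rwa [mul_zero] at this
  have hconv := (ENNReal.tendsto_nat_tsum fun n => pathMeasure P i (avoiding j n)).add hElim
  simp only [hsum, add_zero] at hconv
  rw [meanHittingTime_eq_tsum]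
  exact tendsto_nhds_unique hconv tendsto_const_nhds

/-- The chain has a well-defined Kemeny's constant as soon as the first-step equations for the
hitting times have a finite solution, a stationary distribution exists, and the weighted sums of the
solution do not depend on the initial state. -/
theorem hasKemenyConstant_of_firstStep (P : V → PMF V) (π : PMF V) (hπ : IsStationary P π)
    (h : V → V → ℝ≥0∞) (hfin : ∀ i j, h i j ≠ ∞) (hdiag : ∀ j, h j j = 0)
    (hstep : ∀ i j, i ≠ j → h i j = 1 + ∑ k, P i k * h k j) (K : ℝ)
    (hK : ∀ i, (∑ j, π j * h i j).toReal = K) : HasKemenyConstant P K := by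
  have huniq : ∀ π' : PMF V, IsStationary P π' → π' = π := fun π' hπ' => by
    ext j
    have h1 := hπ.apply_mul_eq_one j (h · j) (hfin · j) (hdiag j) (hstep · j)
    have h2 := hπ'.apply_mul_eq_one j (h · j) (hfin · j) (hdiag j) (hstep · j)
    rw [ENNReal.eq_inv_of_mul_eq_one_left h1, ENNReal.eq_inv_of_mul_eq_one_left h2]
  refine ⟨⟨π, hπ, huniq⟩, fun π' hπ' i => ?_⟩
  rw [huniq π' hπ']
  have hm : ∀ j, meanHittingTime P i j = h i j := fun j =>
    meanHittingTime_eq_of_firstStep P j (h · j) (hfin · j) (hdiag j) (hstep · j) i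
  simp_rw [hm]
  exact ⟨ENNReal.sum_ne_top.2 fun j _ => ENNReal.mul_ne_top (π.apply_ne_top j) (hfin i j), hK i⟩

end FirstStep

end MarkovChain

namespace SimpleGraph

/-! ### Random walks on graphs and the resistance formula. -/

section RandomWalk

variable {V : Type*} [Fintype V] (G : SimpleGraph V) [DecidableRel G.Adj]

lemma randomWalk_apply {v : V} (hv : 0 < G.degree v) (w : V) :
    G.randomWalk v w = if G.Adj v w then (G.degree v : ℝ≥0∞)⁻¹ else 0 := by
  classical
  have hne : (G.neighborFinset v).Nonempty := Finset.card_pos.1 hv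
  unfold randomWalk
  rw [dif_pos (by convert hne), PMF.uniformOfFinset_apply]
  simp only [mem_neighborFinset, card_neighborFinset_eq_degree]
  congr!

/-- The stationary distribution of the random walk on a graph, proportional to the degrees. -/
noncomputable def degreePMF (h : ∑ v, G.degree v ≠ 0) : PMF V :=
  PMF.ofFintype (fun v => (G.degree v : ℝ≥0∞) / ((∑ w, G.degree w : ℕ) : ℝ≥0∞)) (by
    simp_rw [div_eq_mul_inv, ← Finset.sum_mul]
    rw [← Nat.cast_sum]
    exact ENNReal.mul_inv_cancel (by exact_mod_cast h) (ENNReal.natCast_ne_top _))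

lemma degreePMF_apply (h : ∑ v, G.degree v ≠ 0) (v : V) :
    G.degreePMF h v = (G.degree v : ℝ≥0∞) / ((∑ w, G.degree w : ℕ) : ℝ≥0∞) := rfl

lemma isStationary_degreePMF (hdeg : ∀ v, 0 < G.degree v) (h : ∑ v, G.degree v ≠ 0) :
    MarkovChain.IsStationary G.randomWalk (G.degreePMF h) := by
  refine PMF.ext fun w => ?_
  have hterm : ∀ v, G.degreePMF h v * G.randomWalk v w =
      if G.Adj w v then ((∑ w, G.degree w : ℕ) : ℝ≥0∞)⁻¹ else 0 := fun v => by
    rw [degreePMF_apply, randomWalk_apply G (hdeg v)]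
    simp_rw [G.adj_comm w v]
    split_ifs
    · rw [div_eq_mul_inv, mul_right_comm, ENNReal.mul_inv_cancel
        (by exact_mod_cast (hdeg v).ne') (ENNReal.natCast_ne_top _), one_mul]
    · rw [mul_zero]
  rw [PMF.bind_apply, tsum_fintype, Finset.sum_congr rfl fun v _ => hterm v,
    ← Finset.sum_filter, Finset.sum_const, nsmul_eq_mul, degreePMF_apply, div_eq_mul_inv,
    ← card_neighborFinset_eq_degree, neighborFinset_eq_filter]

lemma sum_randomWalk_mul_ofReal {v : V} (hv : 0 < G.degree v) {f : V → ℝ} (hf : ∀ w, 0 ≤ f w) :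
    ∑ w, G.randomWalk v w * ENNReal.ofReal (f w) =
      ENNReal.ofReal ((∑ w ∈ G.neighborFinset v, f w) / G.degree v) := by
  rw [ENNReal.ofReal_div_of_pos (by exact_mod_cast hv), ENNReal.ofReal_natCast,
    ENNReal.ofReal_sum_of_nonneg fun w _ => hf w, div_eq_mul_inv, Finset.sum_mul,
    neighborFinset_eq_filter, Finset.sum_filter]
  refine Finset.sum_congr rfl fun w _ => ?_
  rw [randomWalk_apply G hv]
  split_ifs
  · exact mul_comm _ _
  · exact zero_mul _

/-- Kemeny's constant of a graph in terms of its resistance metric: if `r` is a quasimetric such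
that the graph Laplacian maps each `r (·, j)` to `τ - 2 δ_j` for a fixed function `τ`, then
Kemeny's constant is `∑ d_j d_k r(j, k) / (2 ∑ d_j)`. -/
theorem hasKemenyConstant_of_resistance [DecidableEq V] [Nonempty V] [MeasurableSpace V]
    [DiscreteMeasurableSpace V] (hdeg : ∀ v, 0 < G.degree v) (r : V → V → ℝ) (τ : V → ℝ)
    (hdiag : ∀ j, r j j = 0) (htri : ∀ i j k, r i k ≤ r i j + r j k)
    (hlap : ∀ i j, ∑ k ∈ G.neighborFinset i, (r i j - r k j) = τ i - if i = j then 2 else 0) :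
    MarkovChain.HasKemenyConstant G.randomWalk
      ((∑ j, ∑ k, (G.degree j : ℝ) * G.degree k * r j k) / (2 * ∑ j, (G.degree j : ℝ))) := by
  have hpos : 0 < ∑ v, G.degree v := Finset.sum_pos (fun v _ => hdeg v) Finset.univ_nonempty
  set S : ℝ := ∑ j, (G.degree j : ℝ) with hS
  have hSpos : 0 < S := by rw [hS]; exact_mod_cast hpos
  set h : V → V → ℝ := fun i j => (∑ l, (G.degree l : ℝ) * (r i j + r j l - r i l)) / 2 with hh
  have hnonneg : ∀ i j, 0 ≤ h i j := fun i j =>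
    div_nonneg (Finset.sum_nonneg fun l _ =>
      mul_nonneg (Nat.cast_nonneg _) (sub_nonneg.2 (htri i j l))) zero_le_two
  -- The term `r j l` is constant in `i`. The other two contribute `S (τ i - 2 δ_ij)` and `S τ i - 2
  -- d_i`, so their half-difference is free of `τ`.
  have hdelta : ∀ i j, ∑ k ∈ G.neighborFinset i, (h i j - h k j) =
      G.degree i - if i = j then S else 0 := by
    intro i j
    have h1 : ∀ k, h i j - h k j =
        (S * (r i j - r k j) - ∑ l, (G.degree l : ℝ) * (r i l - r k l)) / 2 := by
      intro k
      simp only [hh, hS, Finset.sum_mul, ← sub_div, ← Finset.sum_sub_distrib]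
      congr 1
      exact Finset.sum_congr rfl fun l _ => by ring
    simp_rw [h1, ← Finset.sum_div, Finset.sum_sub_distrib, ← Finset.mul_sum]
    rw [hlap, Finset.sum_comm]
    simp_rw [← Finset.mul_sum, hlap, mul_sub, Finset.sum_sub_distrib,
      ← Finset.sum_mul, ← hS]
    simp
    split_ifs <;> ring
  have hfirst : ∀ i j, i ≠ j →
      h i j = 1 + (∑ k ∈ G.neighborFinset i, h k j) / G.degree i := by
    intro i j hij
    have h1 := hdelta i j
    have hd : (0 : ℝ) < G.degree i := by exact_mod_cast hdeg i
    rw [Finset.sum_sub_distrib, Finset.sum_const, card_neighborFinset_eq_degree, nsmul_eq_mul,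
      if_neg hij, sub_zero] at h1
    field_simp
    linarith
  refine MarkovChain.hasKemenyConstant_of_firstStep _ (G.degreePMF hpos.ne')
    (G.isStationary_degreePMF hdeg hpos.ne') (fun i j => ENNReal.ofReal (h i j))
    (fun _ _ => ENNReal.ofReal_ne_top) (fun j => ?_) (fun i j hij => ?_) _ (fun i => ?_)
  · simp [hh, hdiag]
  · rw [sum_randomWalk_mul_ofReal G (hdeg i) (hnonneg · j), ← ENNReal.ofReal_one,
      ← ENNReal.ofReal_add zero_le_one, hfirst i j hij]
    exact div_nonneg (Finset.sum_nonneg fun k _ => hnonneg k j) (Nat.cast_nonneg _)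
  · rw [ENNReal.toReal_sum fun j _ =>
      ENNReal.mul_ne_top (PMF.apply_ne_top _ _) ENNReal.ofReal_ne_top]
    -- The terms containing `i` are antisymmetric in `j` and `l`, so they cancel in the double sum;
    -- symmetry of `r` is not needed.
    have h1 : ∀ j, (G.degreePMF hpos.ne' j * ENNReal.ofReal (h i j)).toReal =
        (∑ l, (G.degree j * G.degree l * r j l +
          (G.degree j * G.degree l * r i j - G.degree l * G.degree j * r i l))) / (2 * S) := by
      intro j
      rw [ENNReal.toReal_mul, ENNReal.toReal_ofReal (hnonneg i j), degreePMF_apply,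
        ENNReal.toReal_div, ENNReal.toReal_natCast, ENNReal.toReal_natCast, Nat.cast_sum, ← hS,
        div_mul_eq_mul_div]
      simp only [hh]
      rw [← mul_div_assoc, div_div, Finset.mul_sum]
      congr 1
      exact Finset.sum_congr rfl fun l _ => by ring
    simp_rw [h1, ← Finset.sum_div, Finset.sum_add_distrib, Finset.sum_sub_distrib]
    rw [Finset.sum_comm (f := fun j l => (G.degree l : ℝ) * G.degree j * r i l), sub_self,
      add_zero]

end RandomWalk

end SimpleGraph

namespace Barbell

/-! ### The discrete metric on a complete graph with a marked vertex. -/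

section DiscreteMetric

variable {α : Type*} [DecidableEq α]

/-- The discrete metric. -/
def disc (x y : α) : ℝ := if x = y then 0 else 1

lemma disc_self (x : α) : disc x x = 0 := if_pos rfl

lemma disc_comm (x y : α) : disc x y = disc y x := by
  simp only [disc, eq_comm]

lemma disc_triangle (x y z : α) : disc x z ≤ disc x y + disc y z := by
  unfold disc
  split_ifs <;> simp_all

/-- `Option (Fin n)` models `K_{n+1}` with `none` the attaching vertex; the distances from `q` to
all its points add up to `n`. -/
lemma sum_disc_option {n : ℕ} (q : Option (Fin n)) :
    ∑ x, disc (some x) q = n - disc none q := by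
  cases q with
  | none => simp [disc]
  | some y =>
    have h : ∀ x, disc (some x) (some y) = 1 - if x = y then 1 else 0 := fun x => by
      simp only [disc, Option.some_inj]; split_ifs <;> simp
    rw [Finset.sum_congr rfl fun x _ => h x]
    simp [disc]

end DiscreteMetric

/-! ### Sums along a path. -/

section Sums

lemma sum_fin_adjacent {a s : ℕ} (hs : s < a) (g : ℕ → ℝ) :
    (∑ t : Fin a, if s + 1 = t ∨ (t : ℕ) + 1 = s then g t else 0) =
      (if s = 0 then 0 else g (s - 1)) + if s + 1 = a then 0 else g (s + 1) := by
  rw [Fin.sum_univ_eq_sum_range (fun t => if s + 1 = t ∨ t + 1 = s then g t else 0)]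
  have h : ∀ t, (if s + 1 = t ∨ t + 1 = s then g t else 0) =
      (if t + 1 = s then g t else 0) + if s + 1 = t then g t else 0 := fun t => by
    split_ifs <;> first | omega | simp
  simp_rw [h]
  rw [Finset.sum_add_distrib, Finset.sum_ite_eq]
  congr 1
  · rcases s with _ | s
    · simp
    · simp [show s < a by omega]
  · simp only [Finset.mem_range]
    split_ifs <;> first | omega | rfl

lemma sum_range_abs_sub {n p : ℕ} (hp : p ≤ n) :
    ∑ q ∈ Finset.range (n + 1), |(p : ℝ) - q| =
      (p * (p + 1) + (n - p) * (n - p + 1)) / 2 := by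
  induction n, hp using Nat.le_induction with
  | base =>
    have h : ∀ k ≤ p + 1, ∑ q ∈ Finset.range k, |(p : ℝ) - q| = k * p - k * (k - 1) / 2 := by
      intro k hk
      induction k with
      | zero => simp
      | succ k ih =>
        have : (k : ℝ) ≤ p := by exact_mod_cast (by omega : k ≤ p)
        rw [Finset.sum_range_succ, ih (by omega), abs_of_nonneg (by linarith)]
        push_cast; ring
    rw [h _ le_rfl]; push_cast; ring
  | succ n hn ih =>
    have : (p : ℝ) ≤ n := by exact_mod_cast hn
    rw [Finset.sum_range_succ, ih, abs_of_nonpos (by push_cast; linarith)]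
    push_cast; ring

lemma sum_range_sum_abs_sub (n : ℕ) :
    ∑ p ∈ Finset.range (n + 1), ∑ q ∈ Finset.range (n + 1), |(p : ℝ) - q| =
      n * (n + 1) * (n + 2) / 3 := by
  -- The parameter `N` is separated from the upper limit `k` so that the summand stays fixed during
  -- the induction.
  have h : ∀ (N : ℝ) (k : ℕ), ∑ p ∈ Finset.range (k + 1),
      ((p : ℝ) * (p + 1) + (N - p) * (N - p + 1)) / 2 =
        k * (k + 1) * (2 * k + 1) / 6 - N * k * (k + 1) / 2 + (k + 1) * (N ^ 2 + N) / 2 := by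
    intro N k
    induction k with
    | zero => simp; ring
    | succ k ih => rw [Finset.sum_range_succ, ih]; push_cast; ring
  rw [Finset.sum_congr rfl fun p hp =>
    sum_range_abs_sub (Nat.lt_succ_iff.1 (Finset.mem_range.1 hp)), h]
  ring

end Sums

/-! ### Neighbours and degrees in the barbell. -/

section Adjacency

variable {a b c : ℕ}

lemma adj_left_left {x y : Fin b} : (barbell a b c).Adj (.inl x) (.inl y) ↔ x ≠ y := by
  simp [barbell, barbellRel]

lemma adj_left_path {x : Fin b} {s : Fin a} :
    (barbell a b c).Adj (.inl x) (.inr (.inl s)) ↔ (s : ℕ) = 0 := by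
  simp [barbell, barbellRel]

lemma adj_path_left {x : Fin b} {s : Fin a} :
    (barbell a b c).Adj (.inr (.inl s)) (.inl x) ↔ (s : ℕ) = 0 := by
  simp [barbell, barbellRel]

lemma not_adj_left_right {x : Fin b} {z : Fin c} :
    ¬ (barbell a b c).Adj (.inl x) (.inr (.inr z)) := by
  simp [barbell, barbellRel]

lemma not_adj_right_left {x : Fin b} {z : Fin c} :
    ¬ (barbell a b c).Adj (.inr (.inr z)) (.inl x) := by
  simp [barbell, barbellRel]

lemma adj_path_path {s t : Fin a} : (barbell a b c).Adj (.inr (.inl s)) (.inr (.inl t)) ↔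
    (s : ℕ) + 1 = t ∨ (t : ℕ) + 1 = s := by
  simp only [barbell, SimpleGraph.fromRel_adj, barbellRel, ne_eq, Sum.inr.injEq, Sum.inl.injEq,
    and_iff_right_iff_imp]
  rintro h rfl
  omega

lemma adj_path_right {s : Fin a} {z : Fin c} :
    (barbell a b c).Adj (.inr (.inl s)) (.inr (.inr z)) ↔ (s : ℕ) + 1 = a := by
  simp [barbell, barbellRel]

lemma adj_right_path {s : Fin a} {z : Fin c} :
    (barbell a b c).Adj (.inr (.inr z)) (.inr (.inl s)) ↔ (s : ℕ) + 1 = a := by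
  simp [barbell, barbellRel]

lemma adj_right_right {x y : Fin c} :
    (barbell a b c).Adj (.inr (.inr x)) (.inr (.inr y)) ↔ x ≠ y := by
  simp [barbell, barbellRel]

variable [DecidableRel (barbell a b c).Adj]

lemma sum_neighborFinset (v : BarbellVertex a b c) (f : BarbellVertex a b c → ℝ) :
    ∑ w ∈ (barbell a b c).neighborFinset v, f w =
      (∑ x, if (barbell a b c).Adj v (.inl x) then f (.inl x) else 0) +
      ((∑ s, if (barbell a b c).Adj v (.inr (.inl s)) then f (.inr (.inl s)) else 0) +
       ∑ z, if (barbell a b c).Adj v (.inr (.inr z)) then f (.inr (.inr z)) else 0) := by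
  rw [SimpleGraph.neighborFinset_eq_filter, Finset.sum_filter, Fintype.sum_sum_type,
    Fintype.sum_sum_type]

lemma sum_neighborFinset_left (ha : 1 ≤ a) (x : Fin b) (f : BarbellVertex a b c → ℝ) :
    ∑ w ∈ (barbell a b c).neighborFinset (.inl x), f w =
      ∑ y, f (.inl y) - f (.inl x) + f (.inr (.inl ⟨0, ha⟩)) := by
  rw [sum_neighborFinset]
  simp only [adj_left_left, adj_left_path, not_adj_left_right, if_false, Finset.sum_const_zero,
    add_zero]
  congr 1
  · rw [← Finset.sum_erase_eq_sub (Finset.mem_univ x), ← Finset.sum_filter]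
    congr 1; ext y; simp [eq_comm]
  · rw [Finset.sum_eq_single ⟨0, ha⟩]
    · rw [if_pos rfl]
    · exact fun s _ hs => if_neg fun h => hs (Fin.ext h)
    · simp

lemma sum_neighborFinset_right (ha : 1 ≤ a) (z : Fin c) (f : BarbellVertex a b c → ℝ) :
    ∑ w ∈ (barbell a b c).neighborFinset (.inr (.inr z)), f w =
      ∑ y, f (.inr (.inr y)) - f (.inr (.inr z)) + f (.inr (.inl ⟨a - 1, by omega⟩)) := by
  rw [sum_neighborFinset]
  simp only [adj_right_right, adj_right_path, not_adj_right_left, if_false, Finset.sum_const_zero,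
    zero_add]
  rw [add_comm]
  congr 1
  · rw [← Finset.sum_erase_eq_sub (Finset.mem_univ z), ← Finset.sum_filter]
    congr 1; ext y; simp [eq_comm]
  · rw [Finset.sum_eq_single ⟨a - 1, by omega⟩]
    · rw [if_pos (by simp; omega)]
    · intro s _ hs
      rw [if_neg fun h => hs (Fin.ext (by simp; omega))]
    · simp

/-- At an end of the path the adjacent clique replaces the missing path neighbour; for `a = 1` this
happens on both sides of one vertex. Extending `f` to `g` on `ℕ` avoids bounds on indices. -/
lemma sum_neighborFinset_path (s : Fin a) (f : BarbellVertex a b c → ℝ) (g : ℕ → ℝ)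
    (hg : ∀ t : Fin a, f (.inr (.inl t)) = g t) :
    ∑ w ∈ (barbell a b c).neighborFinset (.inr (.inl s)), f w =
      (if (s : ℕ) = 0 then ∑ y, f (.inl y) else g (s - 1)) +
      (if (s : ℕ) + 1 = a then ∑ z, f (.inr (.inr z)) else g (s + 1)) := by
  rw [sum_neighborFinset]
  simp only [adj_path_left, adj_path_path, adj_path_right, hg]
  rw [sum_fin_adjacent s.2 g]
  split_ifs <;> simp

lemma degree_eq_sum (v : BarbellVertex a b c) :
    ((barbell a b c).degree v : ℝ) = ∑ _w ∈ (barbell a b c).neighborFinset v, (1 : ℝ) := by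
  simp

lemma degree_left (ha : 1 ≤ a) (x : Fin b) : ((barbell a b c).degree (.inl x) : ℝ) = b := by
  rw [degree_eq_sum, sum_neighborFinset_left ha]; simp

lemma degree_right (ha : 1 ≤ a) (z : Fin c) :
    ((barbell a b c).degree (.inr (.inr z)) : ℝ) = c := by
  rw [degree_eq_sum, sum_neighborFinset_right ha]; simp

lemma degree_path (s : Fin a) : ((barbell a b c).degree (.inr (.inl s)) : ℝ) =
    (if (s : ℕ) = 0 then (b : ℝ) else 1) + if (s : ℕ) + 1 = a then (c : ℝ) else 1 := by
  rw [degree_eq_sum, sum_neighborFinset_path s _ (fun _ => 1) fun _ => rfl]; simp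

lemma degree_pos (ha : 1 ≤ a) (habc : 2 ≤ a + b + c) (v : BarbellVertex a b c) :
    0 < (barbell a b c).degree v := by
  suffices (0 : ℝ) < (barbell a b c).degree v by exact_mod_cast this
  rcases v with x | s | z
  · rw [degree_left ha]; exact_mod_cast x.pos
  · rw [degree_path]
    split_ifs with h1 h2
    -- Here `a = 1`, so `habc` supplies a vertex outside the path.
    · exact_mod_cast (by omega : 0 < b + c)
    all_goals positivity
  · rw [degree_right ha]; exact_mod_cast z.pos

/-- Every path vertex is given weight `2`, corrected by `b - 1` and `c - 1` at the two ends; the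
corrections add up correctly when the ends coincide. -/
lemma sum_degree_mul (ha : 1 ≤ a) (f : BarbellVertex a b c → ℝ) (g : ℕ → ℝ)
    (hg : ∀ t : Fin a, f (.inr (.inl t)) = g t) :
    ∑ v, ((barbell a b c).degree v : ℝ) * f v =
      b * ∑ x, f (.inl x) + c * ∑ z, f (.inr (.inr z)) + 2 * ∑ s ∈ Finset.range a, g s +
        (b - 1) * g 0 + (c - 1) * g (a - 1) := by
  simp only [Fintype.sum_sum_type, degree_left ha, degree_right ha, degree_path, hg,
    ← Finset.mul_sum]
  rw [Fin.sum_univ_eq_sum_range (fun s => ((if s = 0 then (b : ℝ) else 1) +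
    if s + 1 = a then (c : ℝ) else 1) * g s)]
  have h : ∀ s, ((if s = 0 then (b : ℝ) else 1) + if s + 1 = a then (c : ℝ) else 1) * g s =
      2 * g s + (if s = 0 then (b - 1) * g s else 0) +
        if s = a - 1 then (c - 1) * g s else 0 := fun s => by
    split_ifs <;> first | omega | ring
  simp_rw [h]
  rw [Finset.sum_add_distrib, Finset.sum_add_distrib, Finset.sum_ite_eq', Finset.sum_ite_eq',
    if_pos (Finset.mem_range.2 ha), if_pos (Finset.mem_range.2 (by omega)), ← Finset.mul_sum]
  ring

end Adjacency

/-! ### The resistance metric and its Laplacian. -/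

section Resistance

variable {a b c : ℕ}

/-- The projection of the barbell to the left clique, with all other vertices collapsed. -/
def leftProj : BarbellVertex a b c → Option (Fin b)
  | .inl x => some x
  | _ => none

/-- The projection of the barbell to the right clique, with all other vertices collapsed. -/
def rightProj : BarbellVertex a b c → Option (Fin c)
  | .inr (.inr z) => some z
  | _ => none

/-- The projection of the barbell to its path. -/
def pos : BarbellVertex a b c → ℕ
  | .inl _ => 0
  | .inr (.inl s) => s
  | .inr (.inr _) => a - 1

/-- The effective resistance between two vertices of the barbell. -/
noncomputable def resistance (v w : BarbellVertex a b c) : ℝ :=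
  2 / (b + 1) * disc (leftProj v) (leftProj w) + |(pos v : ℝ) - pos w| +
    2 / (c + 1) * disc (rightProj v) (rightProj w)

section Simp

variable (x : Fin b) (s : Fin a) (z : Fin c)

@[simp] lemma leftProj_left : leftProj (.inl x : BarbellVertex a b c) = some x := rfl
@[simp] lemma leftProj_path : leftProj (.inr (.inl s) : BarbellVertex a b c) = none := rfl
@[simp] lemma leftProj_right : leftProj (.inr (.inr z) : BarbellVertex a b c) = none := rfl
@[simp] lemma rightProj_left : rightProj (.inl x : BarbellVertex a b c) = none := rfl
@[simp] lemma rightProj_path : rightProj (.inr (.inl s) : BarbellVertex a b c) = none := rfl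
@[simp] lemma rightProj_right : rightProj (.inr (.inr z) : BarbellVertex a b c) = some z := rfl
@[simp] lemma pos_left : pos (.inl x : BarbellVertex a b c) = 0 := rfl
@[simp] lemma pos_path : pos (.inr (.inl s) : BarbellVertex a b c) = s := rfl
@[simp] lemma pos_right : pos (.inr (.inr z) : BarbellVertex a b c) = a - 1 := rfl

end Simp

lemma pos_le (v : BarbellVertex a b c) : pos v ≤ a - 1 := by
  rcases v with x | s | z
  · exact Nat.zero_le _
  · exact Nat.le_sub_one_of_lt s.2
  · exact le_rfl

lemma resistance_self (v : BarbellVertex a b c) : resistance v v = 0 := by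
  simp [resistance, disc_self]

lemma resistance_triangle (u v w : BarbellVertex a b c) :
    resistance u w ≤ resistance u v + resistance v w := by
  have h1 := mul_le_mul_of_nonneg_left (disc_triangle (leftProj u) (leftProj v) (leftProj w))
    (by positivity : (0 : ℝ) ≤ 2 / (b + 1))
  have h2 := mul_le_mul_of_nonneg_left (disc_triangle (rightProj u) (rightProj v) (rightProj w))
    (by positivity : (0 : ℝ) ≤ 2 / (c + 1))
  have h3 := abs_sub_le (pos u : ℝ) (pos v) (pos w)
  unfold resistance
  linarith

/-- The value at `v` of the Laplacian of the resistance to a vertex other than `v`. -/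
noncomputable def curvature : BarbellVertex a b c → ℝ
  | .inl _ => 2 / (b + 1)
  | .inr (.inl s) => (if (s : ℕ) = 0 then 2 / ((b : ℝ) + 1) else 1) +
      (if (s : ℕ) + 1 = a then 2 / ((c : ℝ) + 1) else 1) - 2
  | .inr (.inr _) => 2 / (c + 1)

lemma abs_sub_sub_abs_pred {s : ℕ} (hs : s ≠ 0) (t : ℕ) :
    |(s : ℝ) - t| - |((s - 1 : ℕ) : ℝ) - t| = 1 - if s ≤ t then 2 else 0 := by
  obtain ⟨s, rfl⟩ := Nat.exists_eq_succ_of_ne_zero hs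
  simp only [Nat.succ_eq_add_one, Nat.add_sub_cancel]
  split_ifs with h
  · have : (s : ℝ) + 1 ≤ t := by exact_mod_cast h
    rw [abs_of_nonpos (by push_cast; linarith), abs_of_nonpos (by linarith)]
    push_cast; ring
  · have : (t : ℝ) ≤ s := by exact_mod_cast (by omega : t ≤ s)
    rw [abs_of_nonneg (by push_cast; linarith), abs_of_nonneg (by linarith)]
    push_cast; ring

lemma abs_sub_sub_abs_succ (s t : ℕ) :
    |(s : ℝ) - t| - |((s + 1 : ℕ) : ℝ) - t| = 1 - if t ≤ s then 2 else 0 := by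
  split_ifs with h
  · have : (t : ℝ) ≤ s := by exact_mod_cast h
    rw [abs_of_nonneg (by linarith), abs_of_nonneg (by push_cast; linarith)]
    push_cast; ring
  · have : (s : ℝ) + 1 ≤ t := by exact_mod_cast (by omega : s + 1 ≤ t)
    rw [abs_of_nonpos (by linarith), abs_of_nonpos (by push_cast; linarith)]
    push_cast; ring

/-- Only one block's summand of the resistance changes when moving to a neighbour inside that block,
so the blocks at `v` contribute separately. Each contributes its resistance constant, less `2`
unless `w` lies beyond `v` in that block's direction. -/
lemma laplacian_resistance [DecidableRel (barbell a b c).Adj] (ha : 1 ≤ a)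
    (v w : BarbellVertex a b c) :
    ∑ u ∈ (barbell a b c).neighborFinset v, (resistance v w - resistance u w) =
      curvature v - if v = w then 2 else 0 := by
  have hb : (b : ℝ) + 1 ≠ 0 := by positivity
  have hc : (c : ℝ) + 1 ≠ 0 := by positivity
  rcases v with x | s | z
  · rw [sum_neighborFinset_left ha]
    simp only [resistance, leftProj_left, leftProj_path, rightProj_left, rightProj_path,
        pos_left, pos_path, curvature, Nat.cast_zero]
    have h := sum_disc_option (leftProj w)
    have hx : disc (some x) (leftProj w) = 1 - if Sum.inl x = w then 1 else 0 := by
      rcases w with y | t | y <;> simp [disc]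
      split_ifs <;> simp
    have h2 : ∀ A B C D E : ℝ, A * B + C + D - (A * E + C + D) = A * (B - E) := by intros; ring
    simp only [h2, sub_self, mul_zero, sub_zero, ← Finset.mul_sum, Finset.sum_sub_distrib, h]
    simp only [Finset.sum_const, Finset.card_univ, Fintype.card_fin, nsmul_eq_mul, hx]
    split_ifs <;> field_simp <;> ring
  · have hg : ∀ t : Fin a, resistance (.inr (.inl s)) w - resistance (.inr (.inl t)) w =
        |(s : ℝ) - pos w| - |((t : ℕ) : ℝ) - pos w| := fun t => by
      simp only [resistance, leftProj_path, rightProj_path, pos_path]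
      ring
    rw [sum_neighborFinset_path s _ (fun t => |(s : ℝ) - pos w| - |(t : ℝ) - pos w|) hg]
    have hL : (if (s : ℕ) = 0 then
        ∑ y, (resistance (.inr (.inl s)) w - resistance (.inl y : BarbellVertex a b c) w)
        else |(s : ℝ) - pos w| - |((s - 1 : ℕ) : ℝ) - pos w|) =
        (if (s : ℕ) = 0 then 2 / ((b : ℝ) + 1) else 1) -
          if (s : ℕ) ≤ pos w ∧ leftProj w = none then 2 else 0 := by
      by_cases hs : (s : ℕ) = 0
      · have h2 : ∀ A B C D E : ℝ, A * B + C + D - (A * E + C + D) = A * (B - E) := by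
          intros; ring
        simp only [hs, if_true, resistance, leftProj_left, leftProj_path, rightProj_left,
          rightProj_path, pos_left, pos_path, h2, ← Finset.mul_sum, Finset.sum_sub_distrib, sum_disc_option, Nat.zero_le, true_and]
        simp only [Finset.sum_const, Finset.card_univ, Fintype.card_fin, nsmul_eq_mul, disc]
        simp only [eq_comm (a := (none : Option (Fin b)))]
        split_ifs <;> field_simp <;> ring
      · have : ((s : ℕ) ≤ pos w ∧ leftProj w = none) ↔ (s : ℕ) ≤ pos w := by
          rcases w with y | t | y <;> simp
          omega
        simp only [hs, if_false, abs_sub_sub_abs_pred hs, this]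
    have hR : (if (s : ℕ) + 1 = a then
        ∑ y, (resistance (.inr (.inl s)) w - resistance (.inr (.inr y) : BarbellVertex a b c) w)
        else |(s : ℝ) - pos w| - |((s + 1 : ℕ) : ℝ) - pos w|) =
        (if (s : ℕ) + 1 = a then 2 / ((c : ℝ) + 1) else 1) -
          if pos w ≤ s ∧ rightProj w = none then 2 else 0 := by
      by_cases hs : (s : ℕ) + 1 = a
      · have h2 : ∀ A B C D E : ℝ, A + B + C * D - (A + B + C * E) = C * (D - E) := by
          intros; ring
        have h3 : (s : ℕ) = a - 1 := by omega
        rw [if_pos hs, if_pos hs]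
        simp only [resistance, leftProj_path, leftProj_right, rightProj_path, rightProj_right,
          pos_path, pos_right, h3, h2, ← Finset.mul_sum, Finset.sum_sub_distrib, sum_disc_option,
          true_and, pos_le]
        simp only [Finset.sum_const, Finset.card_univ, Fintype.card_fin, nsmul_eq_mul, disc]
        simp only [eq_comm (a := (none : Option (Fin c)))]
        split_ifs <;> field_simp <;> ring
      · have : (pos w ≤ s ∧ rightProj w = none) ↔ pos w ≤ s := by
          have := s.2
          rcases w with y | t | y <;> simp
          omega
        simp only [hs, if_false, abs_sub_sub_abs_succ, this]
    rw [hL, hR]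
    -- The conditions say that `w` is not strictly left, respectively not strictly right, of `s`. At
    -- least one holds, and both hold only at `w = s`.
    have hs : ((if (s : ℕ) ≤ pos w ∧ leftProj w = none then 2 else 0) +
        if pos w ≤ s ∧ rightProj w = none then 2 else 0 : ℝ) =
        2 + if Sum.inr (Sum.inl s) = w then 2 else 0 := by
      have := s.2
      rcases w with y | t | y
      · simp
      · simp only [pos_path, leftProj_path,
          rightProj_path, and_true, Sum.inr.injEq, Sum.inl.injEq, Fin.ext_iff]
        split_ifs <;> first | omega | norm_num
      · simp ; omega
    simp only [curvature]
    linarith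
  · rw [sum_neighborFinset_right ha]
    simp only [resistance, leftProj_path, leftProj_right, rightProj_path,
        rightProj_right, pos_path, pos_right, curvature]
    have h := sum_disc_option (rightProj w)
    have hx : disc (some z) (rightProj w) = 1 - if Sum.inr (Sum.inr z) = w then 1 else 0 := by
      rcases w with y | t | y <;> simp [disc]
      split_ifs <;> simp
    have h2 : ∀ A B C D E : ℝ, A + B + C * D - (A + B + C * E) = C * (D - E) := by intros; ring
    simp only [h2, sub_self, mul_zero, sub_zero, ← Finset.mul_sum, Finset.sum_sub_distrib, h]
    simp only [Finset.sum_const, Finset.card_univ, Fintype.card_fin, nsmul_eq_mul, hx]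
    split_ifs <;> field_simp <;> ring

end Resistance

end Barbell

namespace Barbell

/-! ### The degree-weighted sum of resistances. -/

section KemenySum

variable {a b c : ℕ} [DecidableRel (barbell a b c).Adj]

lemma sum_degree (ha : 1 ≤ a) :
    ∑ v, ((barbell a b c).degree v : ℝ) = b ^ 2 + b + c ^ 2 + c + 2 * (a - 1) := by
  have h := sum_degree_mul (b := b) (c := c) ha (fun _ => 1) (fun _ => 1) fun _ => rfl
  simp only [mul_one] at h
  rw [h]
  simp
  ring

/-- The left clique without its attaching vertex has total degree `b ^ 2`, the value for `q = none`.
Otherwise only one vertex, of degree `b`, is left out of the total degree. Linearity in `disc none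
q` lets the lemma be applied again in the second summation. -/
lemma sum_degree_mul_disc_left (ha : 1 ≤ a) (q : Option (Fin b)) :
    ∑ v : BarbellVertex a b c, ((barbell a b c).degree v : ℝ) * disc (leftProj v) q =
      b ^ 2 + (c ^ 2 + c + 2 * (a - 1)) * disc none q := by
  rw [sum_degree_mul ha _ (fun _ => disc none q) fun _ => rfl]
  simp only [leftProj_left, leftProj_right, sum_disc_option]
  simp
  ring

lemma sum_degree_mul_disc_right (ha : 1 ≤ a) (q : Option (Fin c)) :
    ∑ v : BarbellVertex a b c, ((barbell a b c).degree v : ℝ) * disc (rightProj v) q =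
      c ^ 2 + (b ^ 2 + b + 2 * (a - 1)) * disc none q := by
  rw [sum_degree_mul ha _ (fun _ => disc none q) fun _ => rfl]
  simp only [rightProj_left, rightProj_right, sum_disc_option]
  simp
  ring

lemma sum_degree_mul_pos (ha : 1 ≤ a) (g : ℕ → ℝ) :
    ∑ v : BarbellVertex a b c, ((barbell a b c).degree v : ℝ) * g (pos v) =
      2 * ∑ s ∈ Finset.range a, g s + (b ^ 2 + b - 1) * g 0 + (c ^ 2 + c - 1) * g (a - 1) := by
  rw [sum_degree_mul ha _ g fun _ => rfl]
  simp
  ring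

lemma sum_sum_disc_left (ha : 1 ≤ a) :
    ∑ v : BarbellVertex a b c, ∑ w : BarbellVertex a b c, ((barbell a b c).degree v : ℝ) *
      (barbell a b c).degree w * disc (leftProj v) (leftProj w) =
      b ^ 2 * (b ^ 2 + b + 2 * (c ^ 2 + c + 2 * (a - 1))) := by
  rw [Finset.sum_comm]
  have h : ∀ w : BarbellVertex a b c, ∑ v : BarbellVertex a b c, ((barbell a b c).degree v : ℝ) *
      (barbell a b c).degree w * disc (leftProj v) (leftProj w) =
      b ^ 2 * (barbell a b c).degree w + (c ^ 2 + c + 2 * (a - 1)) *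
        ((barbell a b c).degree w * disc (leftProj w) none) := fun w => by
    simp_rw [mul_right_comm]
    rw [← Finset.sum_mul, sum_degree_mul_disc_left ha, disc_comm none]
    ring
  simp_rw [h]
  rw [Finset.sum_add_distrib, ← Finset.mul_sum, ← Finset.mul_sum, sum_degree ha,
    sum_degree_mul_disc_left ha, disc_self]
  ring

lemma sum_sum_disc_right (ha : 1 ≤ a) :
    ∑ v : BarbellVertex a b c, ∑ w : BarbellVertex a b c, ((barbell a b c).degree v : ℝ) *
      (barbell a b c).degree w * disc (rightProj v) (rightProj w) =
      c ^ 2 * (c ^ 2 + c + 2 * (b ^ 2 + b + 2 * (a - 1))) := by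
  rw [Finset.sum_comm]
  have h : ∀ w : BarbellVertex a b c, ∑ v : BarbellVertex a b c, ((barbell a b c).degree v : ℝ) *
      (barbell a b c).degree w * disc (rightProj v) (rightProj w) =
      c ^ 2 * (barbell a b c).degree w + (b ^ 2 + b + 2 * (a - 1)) *
        ((barbell a b c).degree w * disc (rightProj w) none) := fun w => by
    simp_rw [mul_right_comm]
    rw [← Finset.sum_mul, sum_degree_mul_disc_right ha, disc_comm none]
    ring
  simp_rw [h]
  rw [Finset.sum_add_distrib, ← Finset.mul_sum, ← Finset.mul_sum, sum_degree ha,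
    sum_degree_mul_disc_right ha, disc_self]
  ring

lemma sum_sum_abs_pos (ha : 1 ≤ a) :
    ∑ v : BarbellVertex a b c, ∑ w : BarbellVertex a b c, ((barbell a b c).degree v : ℝ) *
      (barbell a b c).degree w * |(pos v : ℝ) - pos w| =
      (a - 1) * (4 * (a * (a + 1)) / 3 + 2 * (b ^ 2 + b - 1 + (c ^ 2 + c - 1)) * a +
        2 * (b ^ 2 + b - 1) * (c ^ 2 + c - 1)) := by
  simp_rw [mul_assoc, ← Finset.mul_sum]
  rw [sum_degree_mul_pos ha
    (fun p => ∑ w, ((barbell a b c).degree w : ℝ) * |(p : ℝ) - pos w|)]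
  have h : ∀ p : ℕ, ∑ w, ((barbell a b c).degree w : ℝ) * |(p : ℝ) - pos w| =
      2 * ∑ q ∈ Finset.range a, |(p : ℝ) - q| + (b ^ 2 + b - 1) * |(p : ℝ) - (0 : ℕ)| +
        (c ^ 2 + c - 1) * |(p : ℝ) - (a - 1 : ℕ)| :=
    fun p => sum_degree_mul_pos ha fun q => |(p : ℝ) - q|
  simp_rw [h]
  -- Writing `a = n + 1` removes the truncated subtraction in `a - 1`.
  obtain ⟨n, rfl⟩ := Nat.exists_eq_add_of_le' ha
  have h0 := sum_range_abs_sub (Nat.zero_le n)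
  have hn := sum_range_abs_sub (le_refl n)
  have h0' : ∑ p ∈ Finset.range (n + 1), |(p : ℝ) - (0 : ℕ)| = n * (n + 1) / 2 := by
    simp_rw [abs_sub_comm _ ((0 : ℕ) : ℝ)]
    rw [h0]; push_cast; ring
  have hn' : ∑ p ∈ Finset.range (n + 1), |(p : ℝ) - n| = n * (n + 1) / 2 := by
    simp_rw [abs_sub_comm _ (n : ℝ)]
    rw [hn]; ring
  rw [Nat.add_sub_cancel, Finset.sum_add_distrib, Finset.sum_add_distrib, ← Finset.mul_sum,
    ← Finset.mul_sum, ← Finset.mul_sum, sum_range_sum_abs_sub, h0', hn', h0, hn]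
  simp
  ring

lemma sum_sum_resistance (ha : 1 ≤ a) :
    ∑ v : BarbellVertex a b c, ∑ w : BarbellVertex a b c, ((barbell a b c).degree v : ℝ) *
      (barbell a b c).degree w * resistance v w =
      2 / (b + 1) * (b ^ 2 * (b ^ 2 + b + 2 * (c ^ 2 + c + 2 * (a - 1)))) +
      (a - 1) * (4 * (a * (a + 1)) / 3 + 2 * (b ^ 2 + b - 1 + (c ^ 2 + c - 1)) * a +
        2 * (b ^ 2 + b - 1) * (c ^ 2 + c - 1)) +
      2 / (c + 1) * (c ^ 2 * (c ^ 2 + c + 2 * (b ^ 2 + b + 2 * (a - 1)))) := by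
  rw [← sum_sum_disc_left (b := b) (c := c) ha, ← sum_sum_disc_right (b := b) (c := c) ha,
    ← sum_sum_abs_pos ha, Finset.mul_sum, Finset.mul_sum, ← Finset.sum_add_distrib,
    ← Finset.sum_add_distrib]
  refine Finset.sum_congr rfl fun v _ => ?_
  rw [Finset.mul_sum, Finset.mul_sum, ← Finset.sum_add_distrib, ← Finset.sum_add_distrib]
  refine Finset.sum_congr rfl fun w _ => ?_
  unfold resistance
  ring

end KemenySum

end Barbell

theorem mainTheorem4 (a b c : ℕ) (ha : 1 ≤ a) (habc : 2 ≤ a + b + c)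
    (m : ℝ) (hm : m = ((b + 1).choose 2 : ℝ) + ((c + 1).choose 2 : ℝ) + ((a : ℝ) - 1)) :
    MarkovChain.HasKemenyConstant (barbell a b c).randomWalk
      (1 / m *
        (((b + 1).choose 2 : ℝ) *
            ((b : ℝ) ^ 2 / ((b : ℝ) + 1) + ((a : ℝ) - 1) ^ 2 + 2 * (c : ℝ) ^ 2 / ((c : ℝ) + 1)) +
          ((a : ℝ) - 1) *
            ((2 * (a : ℝ) ^ 2 - 4 * (a : ℝ) + 3) / 6 + 2 * (b : ℝ) ^ 2 / ((b : ℝ) + 1) +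
              2 * (c : ℝ) ^ 2 / ((c : ℝ) + 1)) +
          ((c + 1).choose 2 : ℝ) *
            ((c : ℝ) ^ 2 / ((c : ℝ) + 1) + ((a : ℝ) - 1) ^ 2 + 2 * (b : ℝ) ^ 2 / ((b : ℝ) + 1)) +
          2 * ((b + 1).choose 2 : ℝ) * ((c + 1).choose 2 : ℝ) * ((a : ℝ) - 1))) := by
  classical
  have : Nonempty (BarbellVertex a b c) := ⟨.inr (.inl ⟨0, ha⟩)⟩
  have key := (barbell a b c).hasKemenyConstant_of_resistance (Barbell.degree_pos ha habc)
    Barbell.resistance Barbell.curvature Barbell.resistance_self Barbell.resistance_triangle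
    (Barbell.laplacian_resistance ha)
  have hpos : 0 < ∑ v, ((barbell a b c).degree v : ℝ) :=
    Finset.sum_pos (fun v _ => by exact_mod_cast Barbell.degree_pos ha habc v)
      Finset.univ_nonempty
  rw [Barbell.sum_degree ha] at hpos
  rw [Barbell.sum_sum_resistance ha, Barbell.sum_degree ha] at key
  convert key using 1
  -- The total degree is twice the number `m` of edges; its positivity gives `m ≠ 0`.
  have hm' : (b : ℝ) ^ 2 + b + c ^ 2 + c + 2 * (a - 1) = 2 * m := by
    rw [hm, Nat.cast_choose_two, Nat.cast_choose_two]; push_cast; ring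
  have hm0 : m ≠ 0 := by
    rintro rfl
    rw [hm', mul_zero] at hpos
    exact lt_irrefl _ hpos
  have hb : (b : ℝ) + 1 ≠ 0 := by positivity
  have hc : (c : ℝ) + 1 ≠ 0 := by positivity
  rw [hm', Nat.cast_choose_two, Nat.cast_choose_two]
  push_cast
  field_simp
  ring
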